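/- **Theorem.** Let $\mathbb D=\{|z|<1\}$. Let $\alpha_1,\gamma_1,\alpha_2,\gamma_2>0$, $\beta_1,\delta_1,\beta_2,\delta_2\ge 0$ with $\beta_j+\delta_j>0$ for $j=1,2$, and let $\sigma\in\mathbb C$, $|\sigma|<1$. For $j=1,2$ let $$W_j(z)=z\,\Gamma(\alpha_j)\Gamma(\gamma_j)\sum_{n=0}^\infty \frac{z^n}{\Gamma(\alpha_j+n\beta_j)\,\Gamma(\gamma_j+n\delta_j)}$$ be the normalized four-parameter Wright function. Let $f=h+\overline g$ be a normalized harmonic mapping of $\mathbb D$, i.e. $h(z)=z+\sum_{n\ge2}A_nz^n$ and $g(z)=\sum_{n\ge1}B_nz^n$ are analytic in $\mathbb D$ and $|B_1|<1$. Put $$H(z)=z+\sum_{n=2}^\infty\frac{\Gamma(\alpha_1)\Gamma(\gamma_1)A_nz^n}{\Gamma(\alpha_1+(n-1)\beta_1)\Gamma(\gamma_1+(n-1)\delta_1)},\qquad G(z)=\sum_{n=1}^\infty\frac{\Gamma(\alpha_2)\Gamma(\gamma_2)B_nz^n}{\Gamma(\alpha_2+(n-1)\beta_2)\Gamma(\gamma_2+(n-1)\delta_2)},$$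 and $L(f)=H+\overline{\sigma G}$. If (i) $\sum_{n=2}^\infty n|A_n|+\sum_{n=1}^\infty n|B_n|\le 1$, and (ii) $W_1(1)+W_2(1)-2\le 1-|B_1|$, then $L(f)$ is a harmonic close-to-convex mapping, and so is $H+\overline G$. Here $F$ is called a harmonic close-to-convex mapping (a member of $C_{\hat H}$) if on $\mathbb D$ it is a normalized harmonic mapping $F=P+\overline Q$ (in the above sense) which is sense-preserving ($|P'|>|Q'|$ in $\mathbb D$) and univalent in $\mathbb D$, and $F(\mathbb D)$ is a close-to-convex domain, i.e. a domain whose complement is a union of non-crossing closed half-lines (pairwise disjoint, except that the origin of one may lie on another). -/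

import Mathlib

open Metric
open scoped ComplexConjugate

/-- The open unit disk. -/
def unitDisk : Set ℂ := ball (0 : ℂ) 1

/-- The `n`-th Taylor coefficient of `p` at the origin. -/
noncomputable def taylorCoeff (p : ℂ → ℂ) (n : ℕ) : ℂ :=
  iteratedDeriv n p 0 / (n.factorial : ℂ)

/-- `f = h + conj g` on the unit disk, where `h` and `g` are analytic there,
`h(z) = z + ∑_{n ≥ 2} Aₙ zⁿ`, `g(z) = ∑_{n ≥ 1} Bₙ zⁿ` and `|B₁| < 1`:
`f` is a normalized harmonic mapping with analytic part `h` and co-analytic part `g`. -/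
structure IsNormalizedHarmonic (f h g : ℂ → ℂ) : Prop where
  analytic_h : AnalyticOnNhd ℂ h unitDisk
  analytic_g : AnalyticOnNhd ℂ g unitDisk
  h_zero : h 0 = 0
  deriv_h_zero : deriv h 0 = 1
  g_zero : g 0 = 0
  norm_deriv_g_zero : ‖deriv g 0‖ < 1
  eqOn : Set.EqOn f (fun z => h z + conj (g z)) unitDisk

/-- The class of normalized harmonic mappings that are sense-preserving (positive Jacobian
`|h'|² - |g'|²`) and univalent in the unit disk. -/
def ClassSH : Set (ℂ → ℂ) :=
  {f | ∃ h g : ℂ → ℂ, IsNormalizedHarmonic f h g ∧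
    (∀ z ∈ unitDisk, ‖deriv g z‖ < ‖deriv h z‖) ∧ Set.InjOn f unitDisk}

/-- The closed half-line with origin `r.1` and direction `r.2`. -/
def closedHalfLine (r : ℂ × ℂ) : Set ℂ := {w | ∃ t : ℝ, 0 ≤ t ∧ w = r.1 + (t : ℂ) * r.2}

/-- The open half-line with origin `r.1` and direction `r.2`. -/
def openHalfLine (r : ℂ × ℂ) : Set ℂ := {w | ∃ t : ℝ, 0 < t ∧ w = r.1 + (t : ℂ) * r.2}

/-- A domain is close-to-convex if its complement is a union of non-crossing closed half-lines:
the half-lines are pairwise disjoint, except that the origin of one may lie on another. -/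
def IsCloseToConvexDomain (Ω : Set ℂ) : Prop :=
  IsOpen Ω ∧ IsConnected Ω ∧
    ∃ R : Set (ℂ × ℂ), (∀ r ∈ R, r.2 ≠ 0) ∧ Ωᶜ = ⋃ r ∈ R, closedHalfLine r ∧
      R.PairwiseDisjoint openHalfLine

/-- The class of harmonic close-to-convex mappings. -/
def ClassCH : Set (ℂ → ℂ) :=
  {f | f ∈ ClassSH ∧ IsCloseToConvexDomain (f '' unitDisk)}

/-- The four-parameter Wright function `∑ zⁿ / (Γ(α + nβ) Γ(γ + nδ))`. -/
noncomputable def wright (α β γ δ : ℝ) (z : ℂ) : ℂ :=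
  ∑' n : ℕ, z ^ n / ((Real.Gamma (α + n * β) * Real.Gamma (γ + n * δ) : ℝ) : ℂ)

/-- The normalized four-parameter Wright function `W(z) = z Γ(α) Γ(γ) ∑ zⁿ / (Γ(α+nβ) Γ(γ+nδ))`. -/
noncomputable def normalizedWright (α β γ δ : ℝ) (z : ℂ) : ℂ :=
  z * ((Real.Gamma α * Real.Gamma γ : ℝ) : ℂ) * wright α β γ δ z

/-- The convolution (Hadamard product) `p * W` of `p(z) = ∑_{n ≥ 1} pₙ zⁿ` with the normalized
Wright function:
`∑_{n ≥ 1} Γ(α) Γ(γ) pₙ zⁿ / (Γ(α + (n-1)β) Γ(γ + (n-1)δ))`; here `n` is shifted by one. -/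
noncomputable def wrightConv (α β γ δ : ℝ) (p : ℂ → ℂ) (z : ℂ) : ℂ :=
  ∑' n : ℕ, ((Real.Gamma α * Real.Gamma γ /
    (Real.Gamma (α + n * β) * Real.Gamma (γ + n * δ)) : ℝ) : ℂ) * taylorCoeff p (n + 1) * z ^ (n + 1)

/-- The operator `L(f) = h * W₁ + conj (σ (g * W₂))` for `f = h + conj g`. -/
noncomputable def wrightOperator (α₁ β₁ γ₁ δ₁ α₂ β₂ γ₂ δ₂ : ℝ) (σ : ℂ) (h g : ℂ → ℂ) (z : ℂ) : ℂ :=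
  wrightConv α₁ β₁ γ₁ δ₁ h z + conj (σ * wrightConv α₂ β₂ γ₂ δ₂ g z)

/-! Condition (i) makes each n|Aₙ| and n|Bₙ| at most 1. After convolution the weighted coefficients
with n ≥ 2 are therefore dominated by those of the Wright functions, so their sums are at most W₁(1)
- 1 and W₂(1) - 1. Condition (ii) then puts the transformed mapping under the classical criterion ∑
n|aₙ| + ∑ n|bₙ| ≤ 1, where the a-sum starts at n = 2 and the b-sum at n = 1
(`harmonicSeries_mem_classCH`). That criterion holds because such an F is a perturbation of the
identity. The inequality `norm_pow_sub_mul_pow_le`, summed termwise, gives |F(ζ) - tF(z) - (ζ - tz)|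
≤ q|ζ - tz| with q < 1 whenever |z| ≤ |ζ| and 0 ≤ t ≤ 1. Hence F(ζ) = tF(z) forces ζ = tz
(`eq_mul_of_harmonicSeries_eq`). With t = 1 this is univalence and, through the estimate itself,
openness of the image; with general t it makes the image star-shaped about 0. The complement of a
star-shaped domain is a union of radial half-lines, so the domain is close-to-convex. -/

/-! ### An inequality for powers. -/

lemma mul_norm_sub_le_of_norm_le {ζ z : ℂ} {t : ℝ} (ht0 : 0 ≤ t) (ht1 : t ≤ 1)
    (hz : ‖z‖ ≤ ‖ζ‖) : t * ‖z‖ * ‖ζ - z‖ ≤ ‖ζ‖ * ‖ζ - t * z‖ := by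
  have h1 : ‖ζ - z‖ ^ 2 = ‖ζ‖ ^ 2 + ‖z‖ ^ 2 - 2 * (ζ * conj z).re := by
    simp only [← Complex.normSq_eq_norm_sq, Complex.normSq_sub]
  have h2 : ‖ζ - t * z‖ ^ 2 = ‖ζ‖ ^ 2 + t ^ 2 * ‖z‖ ^ 2 - 2 * t * (ζ * conj z).re := by
    simp only [← Complex.normSq_eq_norm_sq, Complex.normSq_apply, Complex.sub_re, Complex.sub_im,
      Complex.mul_re, Complex.mul_im, Complex.ofReal_re, Complex.ofReal_im, Complex.conj_re,
      Complex.conj_im]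
    ring
  have hsq : ‖z‖ ^ 2 ≤ ‖ζ‖ ^ 2 := by gcongr
  have h3 : 0 ≤ ‖ζ‖ ^ 2 - t * ‖z‖ ^ 2 := by nlinarith [sq_nonneg ‖z‖]
  have h4 : 0 ≤ ‖ζ‖ ^ 2 + t * ‖z‖ ^ 2 - 2 * t * (ζ * conj z).re := by
    nlinarith [sq_nonneg ‖ζ - z‖, sq_nonneg ‖ζ‖]
  refine le_of_sq_le_sq ?_ (by positivity)
  rw [mul_pow, mul_pow, mul_pow, h1, h2]
  -- The difference of the squares factors as (|ζ|² - t|z|²)(|ζ|² + t|z|² - 2t Re(ζ z̄)).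
  nlinarith [mul_nonneg h3 h4]

/-- The factor t multiplies zⁿ⁺¹ only once, so this is not the usual Lipschitz bound for powers
applied to ζ and tz. Splitting off ζⁿ(ζ - tz) leaves tz(ζⁿ - zⁿ), which the previous inequality
controls. -/
lemma norm_pow_sub_mul_pow_le {ζ z : ℂ} {t : ℝ} (ht0 : 0 ≤ t) (ht1 : t ≤ 1)
    (hz : ‖z‖ ≤ ‖ζ‖) (n : ℕ) :
    ‖ζ ^ (n + 1) - t * z ^ (n + 1)‖ ≤ (n + 1) * ‖ζ‖ ^ n * ‖ζ - t * z‖ := by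
  rcases n with _ | n
  · simp
  have hpow : ‖ζ ^ (n + 1) - z ^ (n + 1)‖ ≤ (n + 1) * ‖ζ‖ ^ n * ‖ζ - z‖ := by
    rw [← (Commute.all ζ z).geom_sum₂_mul, norm_mul]
    gcongr
    refine (norm_sum_le _ _).trans ?_
    have : ∀ i ∈ Finset.range (n + 1), ‖ζ ^ i * z ^ (n + 1 - 1 - i)‖ ≤ ‖ζ‖ ^ n := by
      intro i hi
      have hi' : i ≤ n := by simpa [Nat.lt_succ_iff] using hi
      rw [norm_mul, norm_pow, norm_pow]
      calc ‖ζ‖ ^ i * ‖z‖ ^ (n + 1 - 1 - i) ≤ ‖ζ‖ ^ i * ‖ζ‖ ^ (n + 1 - 1 - i) := by gcongr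
        _ = ‖ζ‖ ^ n := by rw [← pow_add]; congr 1; omega
    refine (Finset.sum_le_sum this).trans ?_
    simp
  have hsplit : ζ ^ (n + 1 + 1) - t * z ^ (n + 1 + 1) =
      ζ ^ (n + 1) * (ζ - t * z) + t * z * (ζ ^ (n + 1) - z ^ (n + 1)) := by ring
  rw [hsplit]
  refine (norm_add_le _ _).trans ?_
  rw [norm_mul, norm_mul, norm_mul, norm_pow, Complex.norm_real, Real.norm_of_nonneg ht0]
  have h1 := mul_norm_sub_le_of_norm_le ht0 ht1 hz
  calc ‖ζ‖ ^ (n + 1) * ‖ζ - t * z‖ + t * ‖z‖ * ‖ζ ^ (n + 1) - z ^ (n + 1)‖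
      ≤ ‖ζ‖ ^ (n + 1) * ‖ζ - t * z‖ + t * ‖z‖ * ((n + 1) * ‖ζ‖ ^ n * ‖ζ - z‖) := by gcongr
    _ = ‖ζ‖ ^ (n + 1) * ‖ζ - t * z‖ + (n + 1) * ‖ζ‖ ^ n * (t * ‖z‖ * ‖ζ - z‖) := by ring
    _ ≤ ‖ζ‖ ^ (n + 1) * ‖ζ - t * z‖ + (n + 1) * ‖ζ‖ ^ n * (‖ζ‖ * ‖ζ - t * z‖) := by gcongr
    _ = ((n + 1 : ℕ) + 1) * ‖ζ‖ ^ (n + 1) * ‖ζ - t * z‖ := by push_cast; ring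

/-! ### Power series with summable weighted coefficients. -/

/-- The power series `∑ bₙ z^(n+1)`, without constant term. -/
noncomputable def shiftedSeries (b : ℕ → ℂ) (z : ℂ) : ℂ := ∑' n : ℕ, b n * z ^ (n + 1)

/-- The majorant `∑ (n+1) ‖bₙ‖ rⁿ` of the derivative of `shiftedSeries b`. -/
noncomputable def derivMajorant (b : ℕ → ℂ) (r : ℝ) : ℝ := ∑' n : ℕ, ((n : ℝ) + 1) * ‖b n‖ * r ^ n

lemma summable_derivMajorant {b : ℕ → ℂ} (hb : Summable fun n : ℕ => ((n : ℝ) + 1) * ‖b n‖)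
    {r : ℝ} (hr0 : 0 ≤ r) (hr1 : r ≤ 1) :
    Summable fun n : ℕ => ((n : ℝ) + 1) * ‖b n‖ * r ^ n :=
  Summable.of_nonneg_of_le (fun n => by positivity)
    (fun n => mul_le_of_le_one_right (by positivity) (pow_le_one₀ hr0 hr1)) hb

lemma norm_shiftedSeries_term_le (b : ℕ → ℂ) (n : ℕ) {z : ℂ} (hz : ‖z‖ ≤ 1) :
    ‖b n * z ^ (n + 1)‖ ≤ ((n : ℝ) + 1) * ‖b n‖ := by
  rw [norm_mul, norm_pow]
  have h1 : ‖z‖ ^ (n + 1) ≤ 1 := pow_le_one₀ (norm_nonneg _) hz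
  nlinarith [norm_nonneg (b n), mul_nonneg (Nat.cast_nonneg (α := ℝ) n) (norm_nonneg (b n))]

lemma summable_shiftedSeries {b : ℕ → ℂ} (hb : Summable fun n : ℕ => ((n : ℝ) + 1) * ‖b n‖)
    {z : ℂ} (hz : ‖z‖ ≤ 1) : Summable fun n : ℕ => b n * z ^ (n + 1) :=
  Summable.of_norm_bounded hb fun n => norm_shiftedSeries_term_le b n hz

lemma shiftedSeries_zero (b : ℕ → ℂ) : shiftedSeries b 0 = 0 := by simp [shiftedSeries]

lemma norm_lt_one_of_mem {z : ℂ} (hz : z ∈ unitDisk) : ‖z‖ < 1 := by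
  simpa [unitDisk] using hz

lemma isOpen_unitDisk : IsOpen unitDisk := isOpen_ball

lemma differentiableOn_shiftedSeries {b : ℕ → ℂ}
    (hb : Summable fun n : ℕ => ((n : ℝ) + 1) * ‖b n‖) :
    DifferentiableOn ℂ (shiftedSeries b) unitDisk :=
  Complex.differentiableOn_tsum_of_summable_norm hb (fun n => by fun_prop) isOpen_unitDisk
    fun n _ hz => norm_shiftedSeries_term_le b n (norm_lt_one_of_mem hz).le

lemma hasSum_deriv_shiftedSeries {b : ℕ → ℂ}
    (hb : Summable fun n : ℕ => ((n : ℝ) + 1) * ‖b n‖) {z : ℂ} (hz : z ∈ unitDisk) :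
    HasSum (fun n : ℕ => ((n : ℂ) + 1) * b n * z ^ n) (deriv (shiftedSeries b) z) := by
  have h := Complex.hasSum_deriv_of_summable_norm (F := fun n z => b n * z ^ (n + 1)) hb
    (fun n => by fun_prop) isOpen_unitDisk
    (fun n _ hz => norm_shiftedSeries_term_le b n (norm_lt_one_of_mem hz).le) hz
  refine h.congr_fun ?_
  intro n
  simp
  ring

lemma deriv_shiftedSeries_zero {b : ℕ → ℂ}
    (hb : Summable fun n : ℕ => ((n : ℝ) + 1) * ‖b n‖) : deriv (shiftedSeries b) 0 = b 0 := by
  have h := hasSum_deriv_shiftedSeries hb (z := 0) (by simp [unitDisk])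
  refine h.unique ?_
  convert hasSum_single (f := fun n : ℕ => ((n : ℂ) + 1) * b n * 0 ^ n) 0 ?_ using 1
  · simp
  · intro n hn
    simp [hn]

lemma norm_deriv_shiftedSeries_le {b : ℕ → ℂ}
    (hb : Summable fun n : ℕ => ((n : ℝ) + 1) * ‖b n‖) {z : ℂ} (hz : z ∈ unitDisk) :
    ‖deriv (shiftedSeries b) z‖ ≤ derivMajorant b ‖z‖ := by
  rw [← (hasSum_deriv_shiftedSeries hb hz).tsum_eq]
  refine tsum_of_norm_bounded
    (summable_derivMajorant hb (norm_nonneg z) (norm_lt_one_of_mem hz).le).hasSum fun n => ?_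
  have : ‖(n : ℂ) + 1‖ = (n : ℝ) + 1 := by exact_mod_cast Complex.norm_natCast (n + 1)
  simp [this]

lemma norm_shiftedSeries_sub_le {b : ℕ → ℂ}
    (hb : Summable fun n : ℕ => ((n : ℝ) + 1) * ‖b n‖) {ζ z : ℂ} {t r : ℝ}
    (ht0 : 0 ≤ t) (ht1 : t ≤ 1) (hz : ‖z‖ ≤ ‖ζ‖) (hr : ‖ζ‖ ≤ r) (hr1 : r ≤ 1) :
    ‖shiftedSeries b ζ - t * shiftedSeries b z‖ ≤ derivMajorant b r * ‖ζ - t * z‖ := by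
  have h1 := (summable_shiftedSeries hb (hr.trans hr1)).hasSum
  have h2 := ((summable_shiftedSeries hb (hz.trans (hr.trans hr1))).hasSum).mul_left (t : ℂ)
  have h3 := (summable_derivMajorant hb ((norm_nonneg _).trans hr) hr1).hasSum.mul_right
    ‖ζ - t * z‖
  rw [shiftedSeries, shiftedSeries, ← (h1.sub h2).tsum_eq]
  refine tsum_of_norm_bounded h3 fun n => ?_
  have hfac : b n * ζ ^ (n + 1) - t * (b n * z ^ (n + 1)) =
      b n * (ζ ^ (n + 1) - t * z ^ (n + 1)) := by ring
  rw [hfac, norm_mul]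
  calc ‖b n‖ * ‖ζ ^ (n + 1) - t * z ^ (n + 1)‖
      ≤ ‖b n‖ * ((n + 1) * ‖ζ‖ ^ n * ‖ζ - t * z‖) := by
        gcongr; exact norm_pow_sub_mul_pow_le ht0 ht1 hz n
    _ ≤ ‖b n‖ * ((n + 1) * r ^ n * ‖ζ - t * z‖) := by gcongr
    _ = (n + 1) * ‖b n‖ * r ^ n * ‖ζ - t * z‖ := by ring

/-- The sum is at most d₀ + (1 - d₀)r, which is below 1 because d₀ < 1. This supplies the strict
contraction although the coefficient bound allows equality. -/
lemma tsum_mul_pow_lt_one {d : ℕ → ℝ} (hd : Summable d) (hd0 : ∀ n, 0 ≤ d n)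
    (hsum : ∑' n, d n ≤ 1) (h0 : d 0 < 1) {r : ℝ} (hr0 : 0 ≤ r) (hr1 : r < 1) :
    ∑' n, d n * r ^ n < 1 := by
  have hs : Summable fun n => d n * r ^ n :=
    Summable.of_nonneg_of_le (fun n => mul_nonneg (hd0 n) (pow_nonneg hr0 n))
      (fun n => mul_le_of_le_one_right (hd0 n) (pow_le_one₀ hr0 hr1.le)) hd
  have hd' := (summable_nat_add_iff 1).2 hd
  have hle : ∑' n, d (n + 1) * r ^ (n + 1) ≤ (∑' n, d (n + 1)) * r := by
    rw [← tsum_mul_right]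
    refine Summable.tsum_le_tsum (fun n => ?_) ((summable_nat_add_iff 1).2 hs) (hd'.mul_right r)
    refine mul_le_mul_of_nonneg_left ?_ (hd0 _)
    exact pow_le_of_le_one hr0 hr1.le (Nat.succ_ne_zero n)
  rw [hs.tsum_eq_zero_add]
  rw [hd.tsum_eq_zero_add] at hsum
  simp only [pow_zero, mul_one]
  nlinarith

lemma derivMajorant_add_lt_one {a b : ℕ → ℂ}
    (ha : Summable fun n : ℕ => ((n : ℝ) + 1) * ‖a n‖)
    (hb : Summable fun n : ℕ => ((n : ℝ) + 1) * ‖b n‖) (ha0 : a 0 = 0) (hb0 : ‖b 0‖ < 1)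
    (hab : (∑' n : ℕ, ((n : ℝ) + 1) * ‖a n‖) + (∑' n : ℕ, ((n : ℝ) + 1) * ‖b n‖) ≤ 1)
    {r : ℝ} (hr0 : 0 ≤ r) (hr1 : r < 1) : derivMajorant a r + derivMajorant b r < 1 := by
  rw [derivMajorant, derivMajorant, ← (summable_derivMajorant ha hr0 hr1.le).tsum_add
    (summable_derivMajorant hb hr0 hr1.le)]
  simp only [← add_mul]
  refine tsum_mul_pow_lt_one (ha.add hb) (fun n => by positivity) ?_ ?_ hr0 hr1
  · rwa [ha.tsum_add hb]
  · simpa [ha0] using hb0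

/-! ### Univalence, openness and starlikeness from the coefficient bound. -/

/-- The harmonic function `z + ∑ aₙ z^(n+1) + conj (∑ bₙ z^(n+1))`. -/
noncomputable def harmonicSeries (a b : ℕ → ℂ) (z : ℂ) : ℂ :=
  z + shiftedSeries a z + conj (shiftedSeries b z)

lemma norm_harmonicSeries_sub_le {a b : ℕ → ℂ}
    (ha : Summable fun n : ℕ => ((n : ℝ) + 1) * ‖a n‖)
    (hb : Summable fun n : ℕ => ((n : ℝ) + 1) * ‖b n‖) {ζ z : ℂ} {t r : ℝ}
    (ht0 : 0 ≤ t) (ht1 : t ≤ 1) (hz : ‖z‖ ≤ ‖ζ‖) (hr : ‖ζ‖ ≤ r) (hr1 : r ≤ 1) :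
    ‖harmonicSeries a b ζ - t * harmonicSeries a b z - (ζ - t * z)‖ ≤
      (derivMajorant a r + derivMajorant b r) * ‖ζ - t * z‖ := by
  have h1 := norm_shiftedSeries_sub_le ha ht0 ht1 hz hr hr1
  have h2 := norm_shiftedSeries_sub_le hb ht0 ht1 hz hr hr1
  have hsplit : harmonicSeries a b ζ - t * harmonicSeries a b z - (ζ - t * z) =
      (shiftedSeries a ζ - t * shiftedSeries a z) +
        conj (shiftedSeries b ζ - t * shiftedSeries b z) := by
    simp only [harmonicSeries, map_sub, map_mul, Complex.conj_ofReal]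
    ring
  rw [hsplit, add_mul]
  refine (norm_add_le _ _).trans ?_
  rw [Complex.norm_conj]
  exact add_le_add h1 h2

lemma eq_mul_of_harmonicSeries_eq {a b : ℕ → ℂ}
    (ha : Summable fun n : ℕ => ((n : ℝ) + 1) * ‖a n‖)
    (hb : Summable fun n : ℕ => ((n : ℝ) + 1) * ‖b n‖) (ha0 : a 0 = 0) (hb0 : ‖b 0‖ < 1)
    (hab : (∑' n : ℕ, ((n : ℝ) + 1) * ‖a n‖) + (∑' n : ℕ, ((n : ℝ) + 1) * ‖b n‖) ≤ 1)
    {ζ z : ℂ} {t : ℝ} (ht0 : 0 ≤ t) (ht1 : t ≤ 1) (hz : ‖z‖ ≤ ‖ζ‖) (hζ : ‖ζ‖ < 1)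
    (h : harmonicSeries a b ζ = t * harmonicSeries a b z) : ζ = t * z := by
  have h1 := norm_harmonicSeries_sub_le ha hb ht0 ht1 hz le_rfl hζ.le
  have h2 := derivMajorant_add_lt_one ha hb ha0 hb0 hab (norm_nonneg ζ) hζ
  rw [h, sub_self, zero_sub, norm_neg] at h1
  have h3 : ‖ζ - t * z‖ = 0 := by
    by_contra hne
    have := lt_of_le_of_ne (norm_nonneg _) (Ne.symm hne)
    nlinarith
  exact sub_eq_zero.1 (norm_eq_zero.1 h3)

lemma injOn_harmonicSeries {a b : ℕ → ℂ}
    (ha : Summable fun n : ℕ => ((n : ℝ) + 1) * ‖a n‖)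
    (hb : Summable fun n : ℕ => ((n : ℝ) + 1) * ‖b n‖) (ha0 : a 0 = 0) (hb0 : ‖b 0‖ < 1)
    (hab : (∑' n : ℕ, ((n : ℝ) + 1) * ‖a n‖) + (∑' n : ℕ, ((n : ℝ) + 1) * ‖b n‖) ≤ 1) :
    Set.InjOn (harmonicSeries a b) unitDisk := by
  intro ζ hζ z hz h
  rcases le_total ‖z‖ ‖ζ‖ with hle | hle
  · simpa using eq_mul_of_harmonicSeries_eq ha hb ha0 hb0 hab zero_le_one le_rfl hle
      (norm_lt_one_of_mem hζ) (by simpa using h)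
  · simpa using (eq_mul_of_harmonicSeries_eq ha hb ha0 hb0 hab zero_le_one le_rfl hle
      (norm_lt_one_of_mem hz) (by simpa using h.symm)).symm

/-- On each smaller disk F approximates the identity with constant below 1, so the open mapping part
of the inverse function theorem applies there. The constant may tend to 1 at the unit circle, hence
the exhaustion by disks. -/
lemma isOpen_image_harmonicSeries {a b : ℕ → ℂ}
    (ha : Summable fun n : ℕ => ((n : ℝ) + 1) * ‖a n‖)
    (hb : Summable fun n : ℕ => ((n : ℝ) + 1) * ‖b n‖) (ha0 : a 0 = 0) (hb0 : ‖b 0‖ < 1)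
    (hab : (∑' n : ℕ, ((n : ℝ) + 1) * ‖a n‖) + (∑' n : ℕ, ((n : ℝ) + 1) * ‖b n‖) ≤ 1) :
    IsOpen (harmonicSeries a b '' unitDisk) := by
  have hball : ∀ r : ℝ, 0 ≤ r → r < 1 → IsOpen (harmonicSeries a b '' ball 0 r) := by
    intro r hr0 hr1
    have hlt := derivMajorant_add_lt_one ha hb ha0 hb0 hab hr0 hr1
    have hnn : 0 ≤ derivMajorant a r + derivMajorant b r :=
      add_nonneg (tsum_nonneg fun n => by positivity) (tsum_nonneg fun n => by positivity)
    have happ : ApproximatesLinearOn (harmonicSeries a b)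
        ((ContinuousLinearEquiv.refl ℝ ℂ : ℂ ≃L[ℝ] ℂ) : ℂ →L[ℝ] ℂ) (ball 0 r)
        (derivMajorant a r + derivMajorant b r).toNNReal := by
      intro x hx y hy
      rw [Real.coe_toNNReal _ hnn]
      have hx' : ‖x‖ ≤ r := (mem_ball_zero_iff.1 hx).le
      have hy' : ‖y‖ ≤ r := (mem_ball_zero_iff.1 hy).le
      rcases le_total ‖y‖ ‖x‖ with hle | hle
      · simpa using norm_harmonicSeries_sub_le ha hb zero_le_one le_rfl hle hx' hr1.le
      · have h := norm_harmonicSeries_sub_le ha hb zero_le_one le_rfl hle hy' hr1.le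
        rw [Complex.ofReal_one, one_mul, one_mul] at h
        rw [norm_sub_rev x y, ← norm_neg]
        refine le_of_eq_of_le (congrArg norm ?_) h
        change -(harmonicSeries a b x - harmonicSeries a b y - (x - y)) = _
        ring
    refine happ.open_image (ContinuousLinearEquiv.refl ℝ ℂ).toNonlinearRightInverse
      isOpen_ball ?_
    right
    rw [← NNReal.coe_lt_coe, Real.coe_toNNReal _ hnn]
    have hnorm : (ContinuousLinearEquiv.refl ℝ ℂ).toNonlinearRightInverse.nnnorm = 1 :=
      ContinuousLinearMap.nnnorm_id
    simpa [hnorm] using hlt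
  have hunion : harmonicSeries a b '' unitDisk =
      ⋃ r ∈ Set.Ico (0 : ℝ) 1, harmonicSeries a b '' ball 0 r := by
    ext w
    simp only [Set.mem_iUnion, Set.mem_image]
    constructor
    · rintro ⟨z, hz, rfl⟩
      obtain ⟨r, hzr, hr1⟩ := exists_between (norm_lt_one_of_mem hz)
      exact ⟨r, ⟨(norm_nonneg z).trans hzr.le, hr1⟩, z, mem_ball_zero_iff.2 hzr, rfl⟩
    · rintro ⟨r, hr, z, hz, rfl⟩
      exact ⟨z, ball_subset_ball hr.2.le hz, rfl⟩
  rw [hunion]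
  exact isOpen_biUnion fun r hr => hball r hr.1 hr.2

lemma continuousOn_harmonicSeries {a b : ℕ → ℂ}
    (ha : Summable fun n : ℕ => ((n : ℝ) + 1) * ‖a n‖)
    (hb : Summable fun n : ℕ => ((n : ℝ) + 1) * ‖b n‖) :
    ContinuousOn (harmonicSeries a b) unitDisk :=
  (continuousOn_id.add (differentiableOn_shiftedSeries ha).continuousOn).add
    (Complex.continuous_conj.comp_continuousOn (differentiableOn_shiftedSeries hb).continuousOn)

lemma harmonicSeries_zero (a b : ℕ → ℂ) : harmonicSeries a b 0 = 0 := by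
  simp [harmonicSeries, shiftedSeries_zero]

lemma starConvex_image_harmonicSeries {a b : ℕ → ℂ}
    (ha : Summable fun n : ℕ => ((n : ℝ) + 1) * ‖a n‖)
    (hb : Summable fun n : ℕ => ((n : ℝ) + 1) * ‖b n‖) (ha0 : a 0 = 0) (hb0 : ‖b 0‖ < 1)
    (hab : (∑' n : ℕ, ((n : ℝ) + 1) * ‖a n‖) + (∑' n : ℕ, ((n : ℝ) + 1) * ‖b n‖) ≤ 1) :
    StarConvex ℝ 0 (harmonicSeries a b '' unitDisk) := by
  rw [starConvex_zero_iff]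
  rintro _ ⟨z, hz, rfl⟩ t ht0 ht1
  have hz1 := norm_lt_one_of_mem hz
  set F := harmonicSeries a b
  have hsub : closedBall (0 : ℂ) ‖z‖ ⊆ unitDisk := closedBall_subset_ball hz1
  have hU := isOpen_image_harmonicSeries ha hb ha0 hb0 hab
  have hK : IsClosed (F '' closedBall 0 ‖z‖) :=
    ((isCompact_closedBall _ _).image_of_continuousOn
      ((continuousOn_harmonicSeries ha hb).mono hsub)).isClosed
  -- A preimage ζ of sF(z) with |ζ| > |z| would equal sz, which is impossible. So the image meets
  -- the segment only inside a compact set.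
  have hseg : ∀ s : ℝ, 0 ≤ s → s ≤ 1 → s • F z ∈ F '' unitDisk →
      s • F z ∈ F '' closedBall 0 ‖z‖ := by
    rintro s hs0 hs1 ⟨ζ, hζ, h⟩
    refine ⟨ζ, mem_closedBall_zero_iff.2 ?_, h⟩
    by_contra! hlt
    have heq := eq_mul_of_harmonicSeries_eq ha hb ha0 hb0 hab hs0 hs1 hlt.le
      (norm_lt_one_of_mem hζ) (by simpa using h)
    have : ‖ζ‖ ≤ ‖z‖ := by
      rw [heq, norm_mul, Complex.norm_real, Real.norm_of_nonneg hs0]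
      exact mul_le_of_le_one_left (norm_nonneg _) hs1
    exact absurd this (not_le.2 hlt)
  by_contra hnot
  have hpre : IsPreconnected ((fun s : ℝ => s • F z) '' Set.Icc 0 1) :=
    isPreconnected_Icc.image _ (by fun_prop)
  -- The open image and the complement of the compact one cover the segment. If tF(z) were missed,
  -- both would meet it, and by connectedness they would share a point of it, against `hseg`.
  obtain ⟨w, ⟨s, hs, rfl⟩, hwU, hwV⟩ := hpre _ _ hU hK.isOpen_compl
    (by
      rintro _ ⟨s, hs, rfl⟩
      by_cases h : s • F z ∈ F '' unitDisk
      · exact Or.inl h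
      · exact Or.inr fun h' => h (Set.image_mono hsub h'))
    ⟨_, ⟨1, by simp, rfl⟩, by simpa using Set.mem_image_of_mem F hz⟩
    ⟨_, ⟨t, ⟨ht0, ht1⟩, rfl⟩, fun h => hnot (Set.image_mono hsub h)⟩
  exact hwV (hseg s hs.1 hs.2 hwU)

/-! ### Star-shaped domains and the coefficient criterion. -/

lemma isCloseToConvexDomain_of_starConvex {Ω : Set ℂ} (hΩ : IsOpen Ω) (h0 : (0 : ℂ) ∈ Ω)
    (hstar : StarConvex ℝ 0 Ω) : IsCloseToConvexDomain Ω := by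
  rw [starConvex_zero_iff] at hstar
  -- One radial half-line for each first exit point of a ray from 0. Direction equals origin, so its
  -- points are (1 + t)w with t ≥ 0.
  refine ⟨hΩ, ?_, {r | r.1 = r.2 ∧ r.1 ∉ Ω ∧ ∀ t : ℝ, 0 ≤ t → t < 1 → t • r.1 ∈ Ω}, ?_, ?_, ?_⟩
  · have hs : StarConvex ℝ 0 Ω := starConvex_zero_iff.2 hstar
    exact (hs.isPathConnected h0).isConnected
  · rintro ⟨w, v⟩ ⟨h1, h2, -⟩ h3
    simp only at h1 h2 h3
    subst h1
    exact h2 (h3 ▸ h0)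
  · ext u
    simp only [Set.mem_compl_iff, Set.mem_iUnion, exists_prop]
    constructor
    · intro hu
      have hne : ((Set.Icc (0 : ℝ) 1) ∩ {s | s • u ∉ Ω}).Nonempty := ⟨1, by simp, by simpa using hu⟩
      have hcl : IsClosed {s : ℝ | s • u ∉ Ω} :=
        (hΩ.preimage (by fun_prop : Continuous fun s : ℝ => s • u)).isClosed_compl
      obtain ⟨s, ⟨hs, hsu⟩, hmin⟩ := (isCompact_Icc.inter_right hcl).exists_isLeast hne
      have hs0 : 0 < s := by
        refine lt_of_le_of_ne hs.1 ?_
        rintro rfl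
        exact hsu (by simpa using h0)
      refine ⟨(s • u, s • u), ⟨rfl, hsu, fun t ht0 ht1 => ?_⟩, s⁻¹ - 1, ?_, ?_⟩
      · by_contra hcon
        simp only [smul_smul] at hcon
        have := hmin ⟨⟨by positivity, by nlinarith [hs.2]⟩, hcon⟩
        nlinarith
      · have := (one_le_inv₀ hs0).2 hs.2
        linarith
      · have hsC : (s : ℂ) ≠ 0 := by exact_mod_cast hs0.ne'
        simp only [Complex.real_smul]
        push_cast
        field_simp
        ring
    · rintro ⟨⟨w, v⟩, ⟨h1, h2, -⟩, t, ht, hu⟩ huΩ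
      simp only at h1 h2 hu
      subst h1
      refine h2 ?_
      have := hstar huΩ (a := (1 + t)⁻¹) (by positivity) (inv_le_one_of_one_le₀ (by linarith))
      convert this using 1
      have htC : (1 + t : ℂ) ≠ 0 := by exact_mod_cast (by positivity : (1 + t : ℝ) ≠ 0)
      rw [hu, Complex.real_smul]
      push_cast
      field_simp
  -- A common point makes two exit points positive multiples of each other; by `key` both ratios are
  -- at least 1, so they coincide.
  · have key : ∀ w w' : ℂ, ∀ k : ℝ, 0 ≤ k → w = (k : ℂ) * w' → w ∉ Ω →
        (∀ t : ℝ, 0 ≤ t → t < 1 → t • w' ∈ Ω) → 1 ≤ k := by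
      intro w w' k hk0 hw hwΩ hw'
      by_contra! hk
      exact hwΩ (by simpa [hw] using hw' k hk0 hk)
    rintro ⟨w, v⟩ ⟨h1, h2, h3⟩ ⟨w', v'⟩ ⟨h1', h2', h3'⟩ hne
    simp only at h1 h2 h3 h1' h2' h3'
    subst h1 h1'
    refine Set.disjoint_left.2 ?_
    rintro u ⟨s, hs, hu⟩ ⟨s', hs', hu'⟩
    simp only at hu hu'
    have hsC : (1 + s : ℂ) ≠ 0 := by exact_mod_cast (by positivity : (1 + s : ℝ) ≠ 0)
    have hsC' : (1 + s' : ℂ) ≠ 0 := by exact_mod_cast (by positivity : (1 + s' : ℝ) ≠ 0)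
    have heq : (1 + s) * w = (1 + s') * w' := by linear_combination hu' - hu
    have e1 := key w w' ((1 + s') / (1 + s)) (by positivity)
      (by push_cast; field_simp; linear_combination heq) h2 h3'
    have e2 := key w' w ((1 + s) / (1 + s')) (by positivity)
      (by push_cast; field_simp; linear_combination -heq) h2' h3
    rw [le_div_iff₀ (by positivity)] at e1 e2
    have : s = s' := by linarith
    subst this
    exact hne (by rw [mul_left_cancel₀ hsC heq])

theorem harmonicSeries_mem_classCH {a b : ℕ → ℂ}
    (ha : Summable fun n : ℕ => ((n : ℝ) + 1) * ‖a n‖)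
    (hb : Summable fun n : ℕ => ((n : ℝ) + 1) * ‖b n‖) (ha0 : a 0 = 0) (hb0 : ‖b 0‖ < 1)
    (hab : (∑' n : ℕ, ((n : ℝ) + 1) * ‖a n‖) + (∑' n : ℕ, ((n : ℝ) + 1) * ‖b n‖) ≤ 1) :
    harmonicSeries a b ∈ ClassCH := by
  have hda : ∀ z ∈ unitDisk, DifferentiableAt ℂ (shiftedSeries a) z := fun z hz =>
    (differentiableOn_shiftedSeries ha).differentiableAt (isOpen_unitDisk.mem_nhds hz)
  have hderiv : ∀ z ∈ unitDisk,
      deriv (fun z => z + shiftedSeries a z) z = 1 + deriv (shiftedSeries a) z := fun z hz =>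
    ((hasDerivAt_id z).add (hda z hz).hasDerivAt).deriv
  have h0 : (0 : ℂ) ∈ unitDisk := by simp [unitDisk]
  refine ⟨⟨fun z => z + shiftedSeries a z, shiftedSeries b, ⟨?_, ?_, ?_, ?_, ?_, ?_, ?_⟩, ?_,
    injOn_harmonicSeries ha hb ha0 hb0 hab⟩, ?_⟩
  · exact (differentiableOn_id.add (differentiableOn_shiftedSeries ha)).analyticOnNhd
      isOpen_unitDisk
  · exact (differentiableOn_shiftedSeries hb).analyticOnNhd isOpen_unitDisk
  · simp [shiftedSeries_zero]
  · rw [hderiv 0 h0, deriv_shiftedSeries_zero ha, ha0, add_zero]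
  · exact shiftedSeries_zero b
  · rwa [deriv_shiftedSeries_zero hb]
  · exact fun z _ => rfl
  · intro z hz
    rw [hderiv z hz]
    have h1 := norm_deriv_shiftedSeries_le ha hz
    have h2 := norm_deriv_shiftedSeries_le hb hz
    have h3 := derivMajorant_add_lt_one ha hb ha0 hb0 hab (norm_nonneg z) (norm_lt_one_of_mem hz)
    -- Reverse triangle inequality: |1 + a'| ≥ 1 - |a'|.
    have h4 := norm_sub_le (1 + deriv (shiftedSeries a) z) (deriv (shiftedSeries a) z)
    rw [add_sub_cancel_right, norm_one] at h4
    linarith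
  · exact isCloseToConvexDomain_of_starConvex (isOpen_image_harmonicSeries ha hb ha0 hb0 hab)
      ⟨0, h0, harmonicSeries_zero a b⟩ (starConvex_image_harmonicSeries ha hb ha0 hb0 hab)

/-! ### Growth of Γ and summability of the Wright coefficients. -/

/-- For x ≥ 1, restrict Euler's integral to t > 2 and use tˣ⁻¹ ≥ 2ˣ⁻¹; for x ≤ 1, pass to Γ(x + 1) =
xΓ(x) ≤ Γ(x). Exponential growth suffices to compare the Wright coefficients with a geometric series
of ratio 2^(-(β+δ)), even when one of β, δ vanishes. -/
lemma two_rpow_mul_exp_le_Gamma {x : ℝ} (hx : 0 < x) :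
    2 ^ (x - 1) * Real.exp (-2) ≤ Real.Gamma x := by
  have key : ∀ y : ℝ, 1 ≤ y → 2 ^ (y - 1) * Real.exp (-2) ≤ Real.Gamma y := by
    intro y hy
    have hint := Real.GammaIntegral_convergent (zero_lt_one.trans_le hy)
    have hsub : Set.Ioi (2 : ℝ) ⊆ Set.Ioi 0 := Set.Ioi_subset_Ioi zero_le_two
    rw [Real.Gamma_eq_integral (zero_lt_one.trans_le hy), ← integral_exp_neg_Ioi 2,
      ← MeasureTheory.integral_const_mul]
    calc ∫ t in Set.Ioi (2 : ℝ), 2 ^ (y - 1) * Real.exp (-t)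
        ≤ ∫ t in Set.Ioi (2 : ℝ), Real.exp (-t) * t ^ (y - 1) := by
          refine MeasureTheory.setIntegral_mono_on ((integrableOn_exp_neg_Ioi 2).const_mul _)
            (hint.mono_set hsub) measurableSet_Ioi fun t ht => ?_
          rw [mul_comm]
          gcongr
          exact le_of_lt ht
      _ ≤ ∫ t in Set.Ioi (0 : ℝ), Real.exp (-t) * t ^ (y - 1) := by
          refine MeasureTheory.setIntegral_mono_set hint ?_ hsub.eventuallyLE
          refine (MeasureTheory.ae_restrict_iff' measurableSet_Ioi).2 (.of_forall fun t ht => ?_)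
          have : (0 : ℝ) < t := ht
          simp only [Pi.zero_apply]
          positivity
  rcases le_total 1 x with h | h
  · exact key x h
  · have h1 := key (x + 1) (by linarith)
    rw [Real.Gamma_add_one hx.ne'] at h1
    have h2 : (2 : ℝ) ^ (x - 1) ≤ 2 ^ (x + 1 - 1) := by gcongr <;> norm_num
    have h3 := Real.Gamma_pos_of_pos hx
    calc 2 ^ (x - 1) * Real.exp (-2) ≤ 2 ^ (x + 1 - 1) * Real.exp (-2) := by gcongr
      _ ≤ x * Real.Gamma x := h1
      _ ≤ Real.Gamma x := mul_le_of_le_one_left h3.le h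

/-- The Taylor coefficients `Γ(α) Γ(γ) / (Γ(α+nβ) Γ(γ+nδ))` of the normalized Wright function. -/
noncomputable def wrightCoeff (α β γ δ : ℝ) (n : ℕ) : ℝ :=
  Real.Gamma α * Real.Gamma γ / (Real.Gamma (α + n * β) * Real.Gamma (γ + n * δ))

lemma wrightCoeff_pos {α β γ δ : ℝ} (hα : 0 < α) (hγ : 0 < γ) (hβ : 0 ≤ β) (hδ : 0 ≤ δ) (n : ℕ) :
    0 < wrightCoeff α β γ δ n := by
  have h1 := Real.Gamma_pos_of_pos hα
  have h2 := Real.Gamma_pos_of_pos hγ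
  have h3 := Real.Gamma_pos_of_pos (by positivity : 0 < α + n * β)
  have h4 := Real.Gamma_pos_of_pos (by positivity : 0 < γ + n * δ)
  unfold wrightCoeff
  positivity

lemma wrightCoeff_zero {α γ : ℝ} (hα : 0 < α) (hγ : 0 < γ) (β δ : ℝ) :
    wrightCoeff α β γ δ 0 = 1 := by
  have h1 := Real.Gamma_pos_of_pos hα
  have h2 := Real.Gamma_pos_of_pos hγ
  simp only [wrightCoeff, Nat.cast_zero, zero_mul, add_zero]
  exact div_self (by positivity)

lemma summable_wrightCoeff {α β γ δ : ℝ} (hα : 0 < α) (hγ : 0 < γ) (hβ : 0 ≤ β) (hδ : 0 ≤ δ)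
    (hβδ : 0 < β + δ) : Summable (wrightCoeff α β γ δ) := by
  have hq : (2 : ℝ) ^ (-(β + δ)) < 1 :=
    Real.rpow_lt_one_of_one_lt_of_neg one_lt_two (by linarith)
  have hgeo := (summable_geometric_of_lt_one (by positivity) hq).mul_left
    (Real.Gamma α * Real.Gamma γ / (2 ^ (α - 1 + (γ - 1)) * Real.exp (-2) ^ 2))
  refine Summable.of_nonneg_of_le (fun n => (wrightCoeff_pos hα hγ hβ hδ n).le) (fun n => ?_) hgeo
  have h1 := Real.Gamma_pos_of_pos hα
  have h2 := Real.Gamma_pos_of_pos hγ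
  have h3 := two_rpow_mul_exp_le_Gamma (by positivity : 0 < α + n * β)
  have h4 := two_rpow_mul_exp_le_Gamma (by positivity : 0 < γ + n * δ)
  have hpow : ((2 : ℝ) ^ (-(β + δ))) ^ n = ((2 : ℝ) ^ (n * (β + δ)))⁻¹ := by
    rw [← Real.rpow_mul_natCast zero_le_two, ← Real.rpow_neg zero_le_two]
    congr 1
    ring
  have hprod : (2 : ℝ) ^ (α - 1 + (γ - 1)) * Real.exp (-2) ^ 2 * 2 ^ (n * (β + δ)) =
      (2 ^ (α + n * β - 1) * Real.exp (-2)) * (2 ^ (γ + n * δ - 1) * Real.exp (-2)) := by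
    have : (2 : ℝ) ^ (α - 1 + (γ - 1)) * 2 ^ (n * (β + δ)) =
        2 ^ (α + n * β - 1) * 2 ^ (γ + n * δ - 1) := by
      rw [← Real.rpow_add zero_lt_two, ← Real.rpow_add zero_lt_two]
      congr 1
      ring
    linear_combination Real.exp (-2) ^ 2 * this
  rw [hpow, ← div_eq_mul_inv, div_div, hprod, wrightCoeff]
  gcongr

lemma re_normalizedWright_one {α β γ δ : ℝ} (hα : 0 < α) (hγ : 0 < γ) (hβ : 0 ≤ β) (hδ : 0 ≤ δ)
    (hβδ : 0 < β + δ) :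
    (normalizedWright α β γ δ 1).re = 1 + ∑' n, wrightCoeff α β γ δ (n + 1) := by
  have h : normalizedWright α β γ δ 1 = ((∑' n, wrightCoeff α β γ δ n : ℝ) : ℂ) := by
    rw [normalizedWright, wright, one_mul, ← tsum_mul_left, Complex.ofReal_tsum]
    refine tsum_congr fun n => ?_
    simp only [wrightCoeff, one_pow]
    push_cast
    ring
  rw [h, Complex.ofReal_re, (summable_wrightCoeff hα hγ hβ hδ hβδ).tsum_eq_zero_add,
    wrightCoeff_zero hα hγ]

/-! ### Convolution with the Wright functions. -/

lemma taylorCoeff_one (p : ℂ → ℂ) : taylorCoeff p 1 = deriv p 0 := by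
  simp [taylorCoeff, iteratedDeriv_one]

/-- A weighted coefficient series stays summable, with the expected bound, after multiplication
by `c`, if each of its weighted coefficients is at most `1`. -/
lemma summable_and_tsum_le_of_le_one {x c : ℕ → ℝ} (hx0 : ∀ n, 0 ≤ x n) (hx1 : ∀ n, x n ≤ 1)
    (hc0 : ∀ n, 0 ≤ c n) (hc : Summable c) :
    Summable (fun n => c n * x n) ∧ ∑' n, c n * x n ≤ ∑' n, c n := by
  have hle : ∀ n, c n * x n ≤ c n := fun n => mul_le_of_le_one_right (hc0 n) (hx1 n)
  have hs := Summable.of_nonneg_of_le (fun n => mul_nonneg (hc0 n) (hx0 n)) hle hc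
  exact ⟨hs, hs.tsum_le_tsum hle hc⟩

lemma wrightConv_eq_shiftedSeries (α β γ δ : ℝ) (p : ℂ → ℂ) (z : ℂ) :
    wrightConv α β γ δ p z =
      shiftedSeries (fun n => (wrightCoeff α β γ δ n : ℂ) * taylorCoeff p (n + 1)) z := rfl

lemma shiftedSeries_eq_self_add {c : ℕ → ℂ} (hc : Summable fun n : ℕ => ((n : ℝ) + 1) * ‖c n‖)
    (hc0 : c 0 = 1) {z : ℂ} (hz : z ∈ unitDisk) :
    shiftedSeries c z = z + shiftedSeries (Function.update c 0 0) z := by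
  have hs := summable_shiftedSeries hc (norm_lt_one_of_mem hz).le
  have hs' : Summable fun n : ℕ => Function.update c 0 0 n * z ^ (n + 1) := by
    rw [← summable_nat_add_iff 1] at hs ⊢
    simpa using hs
  rw [shiftedSeries, shiftedSeries, hs.tsum_eq_zero_add, hs'.tsum_eq_zero_add]
  simp [hc0]

lemma classCH_congr {F F' : ℂ → ℂ} (hF : F ∈ ClassCH) (h : Set.EqOn F' F unitDisk) :
    F' ∈ ClassCH := by
  obtain ⟨⟨p, q, hpq, hsp, hinj⟩, himg⟩ := hF
  refine ⟨⟨p, q, { hpq with eqOn := h.trans hpq.eqOn }, hsp, ?_⟩, ?_⟩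
  · exact hinj.congr h.symm
  · rwa [h.image_eq]

theorem shiftedSeries_add_conj_mem_classCH {c b : ℕ → ℂ} (hc0 : c 0 = 1) (hb0 : ‖b 0‖ < 1)
    (hc : Summable fun n : ℕ => ((n : ℝ) + 2) * ‖c (n + 1)‖)
    (hb : Summable fun n : ℕ => ((n : ℝ) + 2) * ‖b (n + 1)‖)
    (hcb : (∑' n : ℕ, ((n : ℝ) + 2) * ‖c (n + 1)‖) +
      (∑' n : ℕ, ((n : ℝ) + 2) * ‖b (n + 1)‖) ≤ 1 - ‖b 0‖) :
    (fun z => shiftedSeries c z + conj (shiftedSeries b z)) ∈ ClassCH := by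
  have hcast : ∀ n : ℕ, ((n + 1 : ℕ) : ℝ) + 1 = (n : ℝ) + 2 := fun n => by push_cast; ring
  have hc' : Summable fun n : ℕ => ((n : ℝ) + 1) * ‖c n‖ := by
    rw [← summable_nat_add_iff 1]
    simp only [hcast]
    exact hc
  have hb' : Summable fun n : ℕ => ((n : ℝ) + 1) * ‖b n‖ := by
    rw [← summable_nat_add_iff 1]
    simp only [hcast]
    exact hb
  have ha' : Summable fun n : ℕ => ((n : ℝ) + 1) * ‖Function.update c 0 0 n‖ := by
    rw [← summable_nat_add_iff 1]
    simp only [hcast]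
    simpa using hc
  refine classCH_congr (harmonicSeries_mem_classCH (a := Function.update c 0 0) (b := b)
    ha' hb' (by simp) hb0 ?_) fun z hz => ?_
  · rw [ha'.tsum_eq_zero_add, hb'.tsum_eq_zero_add]
    simp only [hcast]
    simp only [Function.update_self, ne_eq, Nat.add_eq_zero_iff, one_ne_zero, and_false,
      not_false_eq_true, Function.update_of_ne, norm_zero, mul_zero, zero_add, Nat.cast_zero,
      one_mul]
    linarith
  · simp only [harmonicSeries, shiftedSeries_eq_self_add hc' hc0 hz]

/-- A factor τ in the closed disk only shrinks the co-analytic coefficients, so τ = σ and τ = 1 give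
both conclusions at once. -/
theorem wrightConv_add_conj_mem_classCH
    {α₁ β₁ γ₁ δ₁ α₂ β₂ γ₂ δ₂ : ℝ}
    (hα₁ : 0 < α₁) (hγ₁ : 0 < γ₁) (hα₂ : 0 < α₂) (hγ₂ : 0 < γ₂)
    (hβ₁ : 0 ≤ β₁) (hδ₁ : 0 ≤ δ₁) (hβ₂ : 0 ≤ β₂) (hδ₂ : 0 ≤ δ₂)
    (hβδ₁ : 0 < β₁ + δ₁) (hβδ₂ : 0 < β₂ + δ₂) {τ : ℂ} (hτ : ‖τ‖ ≤ 1)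
    {f h g : ℂ → ℂ} (hf : IsNormalizedHarmonic f h g)
    (hA : Summable fun n : ℕ => ((n : ℝ) + 2) * ‖taylorCoeff h (n + 2)‖)
    (hB : Summable fun n : ℕ => ((n : ℝ) + 1) * ‖taylorCoeff g (n + 1)‖)
    (hAB : (∑' n : ℕ, ((n : ℝ) + 2) * ‖taylorCoeff h (n + 2)‖) +
      (∑' n : ℕ, ((n : ℝ) + 1) * ‖taylorCoeff g (n + 1)‖) ≤ 1)
    (hW : (normalizedWright α₁ β₁ γ₁ δ₁ 1).re + (normalizedWright α₂ β₂ γ₂ δ₂ 1).re - 2 ≤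
      1 - ‖taylorCoeff g 1‖) :
    (fun z => wrightConv α₁ β₁ γ₁ δ₁ h z + conj (τ * wrightConv α₂ β₂ γ₂ δ₂ g z)) ∈ ClassCH := by
  have hA0 : 0 ≤ ∑' n : ℕ, ((n : ℝ) + 2) * ‖taylorCoeff h (n + 2)‖ :=
    tsum_nonneg fun n => by positivity
  have hB0 : 0 ≤ ∑' n : ℕ, ((n : ℝ) + 1) * ‖taylorCoeff g (n + 1)‖ :=
    tsum_nonneg fun n => by positivity
  have hA1 : ∀ n : ℕ, ((n : ℝ) + 2) * ‖taylorCoeff h (n + 2)‖ ≤ 1 := fun n =>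
    (hA.le_tsum n fun m _ => by positivity).trans (by linarith)
  have hB1 : ∀ n : ℕ, ((n : ℝ) + 2) * ‖τ * taylorCoeff g (n + 2)‖ ≤ 1 := by
    intro n
    have h1 := hB.le_tsum (n + 1) fun m _ => by positivity
    have h2 : ‖τ * taylorCoeff g (n + 2)‖ ≤ ‖taylorCoeff g (n + 2)‖ := by
      rw [norm_mul]
      exact mul_le_of_le_one_left (norm_nonneg _) hτ
    calc ((n : ℝ) + 2) * ‖τ * taylorCoeff g (n + 2)‖
        ≤ ((n : ℝ) + 2) * ‖taylorCoeff g (n + 2)‖ := by gcongr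
      _ = (((n + 1 : ℕ) : ℝ) + 1) * ‖taylorCoeff g (n + 1 + 1)‖ := by push_cast; ring_nf
      _ ≤ 1 := by linarith
  have hpos₁ := wrightCoeff_pos hα₁ hγ₁ hβ₁ hδ₁
  have hpos₂ := wrightCoeff_pos hα₂ hγ₂ hβ₂ hδ₂
  obtain ⟨hs₁, hle₁⟩ := summable_and_tsum_le_of_le_one (fun n => by positivity) hA1
    (fun n => (hpos₁ (n + 1)).le)
    ((summable_nat_add_iff 1).2 (summable_wrightCoeff hα₁ hγ₁ hβ₁ hδ₁ hβδ₁))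
  obtain ⟨hs₂, hle₂⟩ := summable_and_tsum_le_of_le_one (fun n => by positivity) hB1
    (fun n => (hpos₂ (n + 1)).le)
    ((summable_nat_add_iff 1).2 (summable_wrightCoeff hα₂ hγ₂ hβ₂ hδ₂ hβδ₂))
  rw [re_normalizedWright_one hα₁ hγ₁ hβ₁ hδ₁ hβδ₁,
    re_normalizedWright_one hα₂ hγ₂ hβ₂ hδ₂ hβδ₂] at hW
  set c : ℕ → ℂ := fun n => (wrightCoeff α₁ β₁ γ₁ δ₁ n : ℂ) * taylorCoeff h (n + 1) with hc
  set b : ℕ → ℂ := fun n => (wrightCoeff α₂ β₂ γ₂ δ₂ n : ℂ) * (τ * taylorCoeff g (n + 1)) with hb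
  have hcn : ∀ n : ℕ, wrightCoeff α₁ β₁ γ₁ δ₁ (n + 1) *
      (((n : ℝ) + 2) * ‖taylorCoeff h (n + 2)‖) = ((n : ℝ) + 2) * ‖c (n + 1)‖ := by
    intro n
    simp only [hc]
    rw [norm_mul, Complex.norm_real, Real.norm_of_nonneg (hpos₁ _).le]
    ring
  have hbn : ∀ n : ℕ, wrightCoeff α₂ β₂ γ₂ δ₂ (n + 1) *
      (((n : ℝ) + 2) * ‖τ * taylorCoeff g (n + 2)‖) = ((n : ℝ) + 2) * ‖b (n + 1)‖ := by
    intro n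
    simp only [hb]
    rw [norm_mul (_ : ℂ) (τ * _), Complex.norm_real, Real.norm_of_nonneg (hpos₂ _).le]
    ring
  have hc0 : c 0 = 1 := by
    simp [hc, wrightCoeff_zero hα₁ hγ₁, taylorCoeff_one, hf.deriv_h_zero]
  have hb0 : ‖b 0‖ ≤ ‖taylorCoeff g 1‖ := by
    simp only [hb, wrightCoeff_zero hα₂ hγ₂, Complex.ofReal_one, one_mul, zero_add, norm_mul]
    exact mul_le_of_le_one_left (norm_nonneg _) hτ
  have hg1 : ‖taylorCoeff g 1‖ < 1 := by
    rw [taylorCoeff_one]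
    exact hf.norm_deriv_g_zero
  simp only [hcn] at hs₁ hle₁
  simp only [hbn] at hs₂ hle₂
  have hmul : ∀ z, τ * wrightConv α₂ β₂ γ₂ δ₂ g z = shiftedSeries b z := by
    intro z
    rw [wrightConv_eq_shiftedSeries, shiftedSeries, shiftedSeries, ← tsum_mul_left]
    exact tsum_congr fun n => by simp only [hb]; ring
  simp only [hmul]
  simp only [wrightConv_eq_shiftedSeries]
  exact shiftedSeries_add_conj_mem_classCH hc0 (hb0.trans_lt hg1) hs₁ hs₂ (by linarith)

theorem mainTheorem7
    (α₁ β₁ γ₁ δ₁ α₂ β₂ γ₂ δ₂ : ℝ)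
    (hα₁ : 0 < α₁) (hγ₁ : 0 < γ₁) (hα₂ : 0 < α₂) (hγ₂ : 0 < γ₂)
    (hβ₁ : 0 ≤ β₁) (hδ₁ : 0 ≤ δ₁) (hβ₂ : 0 ≤ β₂) (hδ₂ : 0 ≤ δ₂)
    -- the Wright series converge at `1` (otherwise `W₁(1)`, `W₂(1)` are meaningless)
    (hβδ₁ : 0 < β₁ + δ₁) (hβδ₂ : 0 < β₂ + δ₂)
    (σ : ℂ) (hσ : ‖σ‖ < 1)
    (f h g : ℂ → ℂ) (hf : IsNormalizedHarmonic f h g)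
    (hA : Summable fun n : ℕ => ((n : ℝ) + 2) * ‖taylorCoeff h (n + 2)‖)
    (hB : Summable fun n : ℕ => ((n : ℝ) + 1) * ‖taylorCoeff g (n + 1)‖)
    (hAB : (∑' n : ℕ, ((n : ℝ) + 2) * ‖taylorCoeff h (n + 2)‖) +
      (∑' n : ℕ, ((n : ℝ) + 1) * ‖taylorCoeff g (n + 1)‖) ≤ 1)
    (hW : (normalizedWright α₁ β₁ γ₁ δ₁ 1).re + (normalizedWright α₂ β₂ γ₂ δ₂ 1).re - 2 ≤
      1 - ‖taylorCoeff g 1‖) :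
    wrightOperator α₁ β₁ γ₁ δ₁ α₂ β₂ γ₂ δ₂ σ h g ∈ ClassCH ∧
      (fun z => wrightConv α₁ β₁ γ₁ δ₁ h z + conj (wrightConv α₂ β₂ γ₂ δ₂ g z)) ∈ ClassCH := by
  refine ⟨wrightConv_add_conj_mem_classCH hα₁ hγ₁ hα₂ hγ₂ hβ₁ hδ₁ hβ₂ hδ₂ hβδ₁ hβδ₂ hσ.le hf
    hA hB hAB hW, ?_⟩
  simpa only [one_mul] using wrightConv_add_conj_mem_classCH hα₁ hγ₁ hα₂ hγ₂ hβ₁ hδ₁ hβ₂ hδ₂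
    hβδ₁ hβδ₂ (τ := 1) (by simp) hf hA hB hAB hW
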